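/- **Definitions.** A *Nelson algebra* is a bounded distributive lattice $(A,\vee,\wedge,0,1)$ with operations $\sim$ and $\to$ such that for all $a,b,c\in A$: ${\sim}{\sim}a=a$; $a\le b\iff{\sim}b\le{\sim}a$; $a\wedge{\sim}a\le b\vee{\sim}b$; $a\wedge c\le{\sim}a\vee b\iff c\le a\to b$; $(a\wedge b)\to c=a\to(b\to c)$. It is *defined on an algebraic lattice* if $(A,\le)$ is a complete lattice in which every element is a join of compact elements. Isomorphism of Nelson algebras ($\cong$) means a bijection preserving $\vee,\wedge,\to,\sim,0,1$. For a quasiorder (reflexive transitive relation) $R$ on a set $U$ and $X\subseteq U$ put $R(x)=\{y\mid x\,R\,y\}$, $X^\blacktriangledown=\{x\mid R(x)\subseteq X\}$, $X^\blacktriangle=\{x\mid R(x)\cap X\ne\emptyset\}$. The *rough sets induced by $R$* form the Nelson algebra $\mathbb{RS}_R$ on $\{(X^\blacktriangledown,X^\blacktriangle)\mid X\subseteq U\}$ with coordinatewise $\cup$ and $\cap$, $0=(\emptyset,\emptyset)$, $1=(U,U)$, ${\sim}(A,B)=(U\setminus B,U\setminus A)$ and $(A,B)\to(C,D)=(((U\setminus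 A)\cup C)^\blacktriangledown,(U\setminus A)\cup D)$. A *Monteiro space* $(X,\le,g)$ is a partially ordered set with a map $g\colon X\to X$ such that for all $x,y$: $x\le y$ implies $g(y)\le g(x)$; $g(g(x))=x$; $x\le g(x)$ or $g(x)\le x$; if $x,y\le g(x),g(y)$, then $x,y\le z\le g(x),g(y)$ for some $z$. Its Nelson algebra $\mathbb N_X$ is the set of upsets of $X$ with $\cup$, $\cap$, $\emptyset$, $X$, ${\sim}A=\{x\mid g(x)\notin A\}$ and $A\to B=\{x\mid \forall y\ge x,\ y\in A\Rightarrow y\in{\sim}A\cup B\}$. An isomorphism of Monteiro spaces is an order isomorphism commuting with $g$. **Theorem.** The following structures determine each other up to isomorphism: (i) rough sets induced by quasiorders; (ii) Nelson algebras defined on algebraic lattices; (iii) Nelson algebras defined on $\mathrm T_0$-spaces that are Alexandrov topologies (the lattice being that of the open sets under inclusion); (iv) Monteiro spaces. That is: 1. For every quasiorder $R$ on a set $U$, the Nelson algebra $\mathbb{RS}_R$ is defined on an algebraic lattice; and for every Nelson algebra $\mathbb A$ defined on an algebraic lattice there are a set $U$ and a quasiorder $R$ on $U$ with $\mathbb A\cong\mathbb{RS}_R$.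 2. Every Nelson algebra defined on an Alexandrov $\mathrm T_0$-topology is defined on an algebraic lattice; and every Nelson algebra defined on an algebraic lattice is isomorphic to a Nelson algebra defined on an Alexandrov $\mathrm T_0$-topology. Moreover two Nelson algebras defined on Alexandrov $\mathrm T_0$-topologies on $X$ and $Y$ are isomorphic if and only if some homeomorphism $X\to Y$ carries the operations $\sim,\to$ of the one to those of the other. 3. For every Monteiro space $X$, the upsets of $X$ form an Alexandrov $\mathrm T_0$-topology on $X$ and an algebraic lattice under inclusion (so that $\mathbb N_X$ is a structure of kinds (iii) and (ii)). Conversely, let $\mathbb A$ be a Nelson algebra defined on an algebraic lattice, let $\mathcal J$ be the set of its completely join-irreducible elements (those $j$ such that $j=\bigvee S$ implies $j\in S$), and let $x\triangleleft y\iff y\le x$ on $\mathcal J$. Then $g(j)=\bigwedge\{x\in A\mid x\nleq{\sim}j\}$ defines a map $g\colon\mathcal J\to\mathcal J$, $(\mathcal J,\triangleleft,g)$ is a Monteiro space, and $\mathbb A\cong\mathbb N_{\mathcal J}$. Moreover two Monteiro spaces $X,Y$ are isomorphic if and only if $\mathbb N_X\cong\mathbb N_Y$. -/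

import Mathlib

open Set TopologicalSpace Topology

universe u

/-! ## Nelson algebras -/

/-- A Nelson algebra structure on a bounded distributive lattice: the strong negation `sneg`
and the implication `imp`, subject to the Nelson axioms. -/
class NelsonAlgebra (A : Type u) [DistribLattice A] [BoundedOrder A] where
  sneg : A → A
  imp : A → A → A
  sneg_sneg : ∀ a, sneg (sneg a) = a
  le_iff_sneg_le : ∀ a b, a ≤ b ↔ sneg b ≤ sneg a
  inf_sneg_le : ∀ a b, a ⊓ sneg a ≤ b ⊔ sneg b
  le_imp_iff : ∀ a b c, a ⊓ c ≤ sneg a ⊔ b ↔ c ≤ imp a b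
  inf_imp : ∀ a b c, imp (a ⊓ b) c = imp a (imp b c)

open NelsonAlgebra (sneg imp)

/-- An isomorphism of Nelson algebras: a bijection that preserves all the operations. -/
structure NelsonIso (A B : Type u) [DistribLattice A] [BoundedOrder A] [NelsonAlgebra A]
    [DistribLattice B] [BoundedOrder B] [NelsonAlgebra B] extends A ≃ B where
  map_sup : ∀ a b, toFun (a ⊔ b) = toFun a ⊔ toFun b
  map_inf : ∀ a b, toFun (a ⊓ b) = toFun a ⊓ toFun b
  map_imp : ∀ a b, toFun (imp a b) = imp (toFun a) (toFun b)
  map_sneg : ∀ a, toFun (sneg a) = sneg (toFun a)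
  map_bot : toFun ⊥ = ⊥
  map_top : toFun ⊤ = ⊤

/-- `A ≅ₙ B`: the Nelson algebras `A` and `B` are isomorphic. -/
def NelsonIsomorphic (A B : Type u) [DistribLattice A] [BoundedOrder A] [NelsonAlgebra A]
    [DistribLattice B] [BoundedOrder B] [NelsonAlgebra B] : Prop :=
  Nonempty (NelsonIso A B)

infix:50 " ≅ₙ " => NelsonIsomorphic

/-- An algebraic lattice: a complete lattice (a partial order in which every subset has a
supremum) in which every element is a join of compact elements. -/
def IsAlgebraicLattice (A : Type u) [PartialOrder A] : Prop :=
  (∀ s : Set A, ∃ a, IsLUB s a) ∧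
    ∀ a : A, ∃ s : Set A, (∀ x ∈ s, IsCompactElement x) ∧ IsLUB s a

/-! ## Rough sets induced by a quasiorder -/

section Rough

variable {U : Type u}

/-- The lower approximation of `X`: the points all of whose `R`-successors lie in `X`. -/
def lowerApprox (R : U → U → Prop) (X : Set U) : Set U := {x | ∀ y, R x y → y ∈ X}

/-- The upper approximation of `X`: the points that have an `R`-successor in `X`. -/
def upperApprox (R : U → U → Prop) (X : Set U) : Set U := {x | ∃ y, R x y ∧ y ∈ X}

theorem exists_approx_eq (R : U → U → Prop) [IsPreorder U R] {A B : Set U}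
    (hA : ∀ x y, R x y → x ∈ A → y ∈ A) (hB : ∀ x y, R x y → y ∈ B → x ∈ B) (hAB : A ⊆ B)
    (hS : ∀ x, (∀ y, R x y → y = x) → x ∈ B → x ∈ A) :
    ∃ X, lowerApprox R X = A ∧ upperApprox R X = B := by
  have rfl' : ∀ x, R x x := fun x => refl_of R x
  have tr : ∀ {x y z}, R x y → R y z → R x z := fun h h' => trans_of R h h'
  let S : Set (Set U × Set U) := {p | p.1 ⊆ B \ A ∧ p.2 ⊆ B \ A ∧ Disjoint p.1 p.2 ∧
    (∀ d ∈ p.1, ∃ e, R d e ∧ (e ∈ p.2 ∨ e ∉ B)) ∧ (∀ e ∈ p.2, ∃ d, R e d ∧ (d ∈ p.1 ∨ d ∈ A))}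
  obtain ⟨⟨D, E⟩, hm⟩ := zorn_le₀ S (by
    intro c hc hch
    refine ⟨(⋃ p ∈ c, p.1, ⋃ p ∈ c, p.2), ⟨?_, ?_, ?_, ?_, ?_⟩, ?_⟩
    · exact iUnion₂_subset fun p hp => (hc hp).1
    · exact iUnion₂_subset fun p hp => (hc hp).2.1
    · simp only [disjoint_iUnion_left, disjoint_iUnion_right]
      intro p hp q hq
      rcases hch.total hp hq with h | h
      · exact (hc hq).2.2.1.mono_right h.2
      · exact (hc hp).2.2.1.mono_left h.1
    · intro d hd
      obtain ⟨p, hp, hd⟩ := mem_iUnion₂.1 hd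
      obtain ⟨e, he, h | h⟩ := (hc hp).2.2.2.1 d hd
      · exact ⟨e, he, Or.inl (mem_iUnion₂.2 ⟨p, hp, h⟩)⟩
      · exact ⟨e, he, Or.inr h⟩
    · intro d hd
      obtain ⟨p, hp, hd⟩ := mem_iUnion₂.1 hd
      obtain ⟨e, he, h | h⟩ := (hc hp).2.2.2.2 d hd
      · exact ⟨e, he, Or.inl (mem_iUnion₂.2 ⟨p, hp, h⟩)⟩
      · exact ⟨e, he, Or.inr h⟩
    · exact fun p hp => ⟨subset_biUnion_of_mem (u := fun p : Set U × Set U => p.1) hp,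
        subset_biUnion_of_mem (u := fun p : Set U × Set U => p.2) hp⟩)
  obtain ⟨⟨hD, hE, hDE, hd, he⟩, hmax⟩ := hm
  simp only at hD hE hDE hd he
  have key : ∀ x ∈ B, ∃ y, R x y ∧ (y ∈ A ∨ y ∈ D) := by
    intro x hxB
    by_contra! hx
    have hxE : ∀ y, R x y → y ∉ E := by
      intro y hy hyE
      obtain ⟨d, hyd, h | h⟩ := he y hyE
      · exact (hx d (tr hy hyd)).2 h
      · exact (hx d (tr hy hyd)).1 h
    have ext : ∀ D' E' : Set U, (D', E') ∈ S → D ⊆ D' → E ⊆ E' → D' ⊆ D := fun D' E' h h1 h2 =>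
      (hmax h ⟨h1, h2⟩).1
    by_cases hB' : ∀ y, R x y → y ∈ B
    · have hne : ∀ y : {y // R x y}, ∃ z : {y // R x y}, R y z ∧ z ≠ y := by
        rintro ⟨y, hy⟩
        by_contra! h
        refine (hx y hy).1 (hS y (fun z hz => ?_) (hB' y hy))
        exact congrArg Subtype.val (h ⟨z, tr hy hz⟩ hz)
      obtain ⟨s, hs, hss⟩ : ∃ s : ℕ → {y // R x y}, (∀ n, R (s n) (s (n + 1))) ∧
          ∀ m n, s (2 * m) ≠ s (2 * n + 1) := by
        by_cases hcyc : ∃ y z : {y // R x y}, R y z ∧ R z y ∧ z ≠ y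
        · obtain ⟨y, z, h1, h2, h3⟩ := hcyc
          refine ⟨fun n => if Even n then y else z, fun n => ?_, fun m n => ?_⟩
          · by_cases hn : Even n
            · simp [hn, Nat.even_add_one, h1]
            · simp [hn, Nat.even_add_one, h2]
          · simp [h3.symm]
        · push Not at hcyc
          choose f hf hf' using hne
          let s : ℕ → {y // R x y} := fun n => f^[n] ⟨x, rfl' x⟩
          have hstep : ∀ n, s (n + 1) = f (s n) := fun n => Function.iterate_succ_apply' f n _
          have hs : ∀ n, R (s n) (s (n + 1)) := fun n => by rw [hstep]; exact hf _
          have hmono : ∀ m k, R (s m) (s (m + k)) := by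
            intro m k
            induction k with
            | zero => exact rfl' _
            | succ k ih => exact tr ih (hs _)
          have hlt : ∀ m n, m < n → s m ≠ s n := by
            intro m n hmn heq
            obtain ⟨k, rfl⟩ : ∃ k, n = (m + 1) + k := ⟨n - (m + 1), by omega⟩
            have h1 := hmono (m + 1) k
            rw [← heq] at h1
            have h2 := hcyc _ _ (hs m) h1
            rw [hstep] at h2
            exact hf' _ h2
          refine ⟨s, hs, fun m n => ?_⟩
          rcases Nat.lt_or_ge (2 * m) (2 * n + 1) with h | h
          · exact hlt _ _ h
          · exact (hlt _ _ (by omega)).symm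
      have hW : ∀ y : {y // R x y}, (y : U) ∈ B \ A := fun y => ⟨hB' _ y.2, (hx _ y.2).1⟩
      have := ext (D ∪ {y | ∃ n, y = s (2 * n)}) (E ∪ {y | ∃ n, y = s (2 * n + 1)}) ⟨?_, ?_, ?_, ?_, ?_⟩
        subset_union_left subset_union_left
      · exact (hx _ (s (2 * 0)).2).2 (this (Or.inr ⟨0, rfl⟩))
      · rintro y (h | ⟨n, rfl⟩)
        exacts [hD h, hW _]
      · rintro y (h | ⟨n, rfl⟩)
        exacts [hE h, hW _]
      · rw [Set.disjoint_left]
        rintro y (h | ⟨n, rfl⟩) (h' | ⟨k, h'⟩)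
        · exact Set.disjoint_left.1 hDE h h'
        · exact (hx _ (s _).2).2 (h' ▸ h)
        · exact hxE _ (s _).2 h'
        · exact hss _ _ (Subtype.ext h')
      · rintro y (h | ⟨n, rfl⟩)
        · obtain ⟨e, h1, h2 | h2⟩ := hd y h
          exacts [⟨e, h1, Or.inl (Or.inl h2)⟩, ⟨e, h1, Or.inr h2⟩]
        · exact ⟨_, hs _, Or.inl (Or.inr ⟨n, rfl⟩)⟩
      · rintro y (h | ⟨n, rfl⟩)
        · obtain ⟨e, h1, h2 | h2⟩ := he y h
          exacts [⟨e, h1, Or.inl (Or.inl h2)⟩, ⟨e, h1, Or.inr h2⟩]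
        · exact ⟨_, hs _, Or.inl (Or.inr ⟨n + 1, rfl⟩)⟩
    · push Not at hB'
      obtain ⟨y, hxy, hyB⟩ := hB'
      have := ext (insert x D) E ⟨?_, hE, ?_, ?_, ?_⟩ (subset_insert _ _) subset_rfl
      · exact (hx x (rfl' x)).2 (this (mem_insert _ _))
      · rintro z (rfl | h)
        exacts [⟨hxB, (hx z (rfl' z)).1⟩, hD h]
      · rw [Set.disjoint_left]
        rintro z (rfl | h) h'
        exacts [hxE _ (rfl' z) h', Set.disjoint_left.1 hDE h h']
      · rintro z (rfl | h)
        exacts [⟨y, hxy, Or.inr hyB⟩, hd z h]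
      · intro z h
        obtain ⟨e, h1, h2 | h2⟩ := he z h
        exacts [⟨e, h1, Or.inl (Or.inr h2)⟩, ⟨e, h1, Or.inr h2⟩]
  refine ⟨A ∪ D, ?_, ?_⟩
  · ext x
    refine ⟨fun h => ?_, fun h y hy => Or.inl (hA x y hy h)⟩
    rcases h x (rfl' x) with h' | h'
    · exact h'
    · obtain ⟨e, h1, h2⟩ := hd x h'
      rcases h e h1 with h3 | h3
      · rcases h2 with h2 | h2
        exacts [((hE h2).2 h3).elim, (h2 (hAB h3)).elim]
      · rcases h2 with h2 | h2
        exacts [(Set.disjoint_left.1 hDE h3 h2).elim, (h2 (hD h3).1).elim]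
  · ext x
    refine ⟨?_, key x⟩
    rintro ⟨y, hy, h | h⟩
    exacts [hB x y hy (hAB h), hB x y hy (hD h).1]

theorem mem_roughSets_iff (R : U → U → Prop) [IsPreorder U R] (p : Set U × Set U) :
    (∃ X, p = (lowerApprox R X, upperApprox R X)) ↔
      (∀ x y, R x y → x ∈ p.1 → y ∈ p.1) ∧ (∀ x y, R x y → y ∈ p.2 → x ∈ p.2) ∧ p.1 ⊆ p.2 ∧
        ∀ x, (∀ y, R x y → y = x) → x ∈ p.2 → x ∈ p.1 := by
  constructor
  · rintro ⟨X, rfl⟩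
    refine ⟨fun x y h hx z hz => hx z (trans_of R h hz),
      fun x y h ⟨z, hz, hX⟩ => ⟨z, trans_of R h hz, hX⟩,
      fun x hx => ⟨x, refl_of R x, hx x (refl_of R x)⟩, fun x hx ⟨y, hy, hX⟩ z hz => ?_⟩
    rw [hx z hz, ← hx y hy]
    exact hX
  · rintro ⟨h1, h2, h3, h4⟩
    obtain ⟨X, hl, hu⟩ := exists_approx_eq R h1 h2 h3 h4
    exact ⟨X, by rw [hl, hu]⟩

/-- The rough sets `(X▼, X▲)`, `X ⊆ U`, as a sublattice of `℘(U) × ℘(U)` with the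
coordinatewise order (so joins and meets are coordinatewise unions and intersections). -/
def roughSets (R : U → U → Prop) [IsPreorder U R] : Sublattice (Set U × Set U) where
  carrier := {p | ∃ X, p = (lowerApprox R X, upperApprox R X)}
  supClosed' := by
    intro p hp q hq
    simp only [mem_ofPred_eq, mem_roughSets_iff] at hp hq ⊢
    obtain ⟨a1, a2, a3, a4⟩ := hp
    obtain ⟨b1, b2, b3, b4⟩ := hq
    exact ⟨fun x y h => Or.imp (a1 x y h) (b1 x y h), fun x y h => Or.imp (a2 x y h) (b2 x y h),
      fun x => Or.imp (@a3 x) (@b3 x), fun x h => Or.imp (a4 x h) (b4 x h)⟩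
  infClosed' := by
    intro p hp q hq
    simp only [mem_ofPred_eq, mem_roughSets_iff] at hp hq ⊢
    obtain ⟨a1, a2, a3, a4⟩ := hp
    obtain ⟨b1, b2, b3, b4⟩ := hq
    exact ⟨fun x y h => And.imp (a1 x y h) (b1 x y h), fun x y h => And.imp (a2 x y h) (b2 x y h),
      fun x => And.imp (@a3 x) (@b3 x), fun x h => And.imp (a4 x h) (b4 x h)⟩

/-- The rough set system `RS` induced by the quasiorder `R`. -/
abbrev RoughSet (R : U → U → Prop) [IsPreorder U R] : Type u := roughSets R

instance (R : U → U → Prop) [IsPreorder U R] : BoundedOrder (RoughSet R) where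
  top := ⟨(univ, univ), (mem_roughSets_iff R _).2 (by simp)⟩
  bot := ⟨(∅, ∅), (mem_roughSets_iff R _).2 (by simp)⟩
  le_top p := ⟨subset_univ _, subset_univ _⟩
  bot_le p := ⟨empty_subset _, empty_subset _⟩

instance (R : U → U → Prop) [IsPreorder U R] : NelsonAlgebra (RoughSet R) where
  sneg p := ⟨(p.1.2ᶜ, p.1.1ᶜ), by
    obtain ⟨h1, h2, h3, h4⟩ := (mem_roughSets_iff R _).1 p.2
    exact (mem_roughSets_iff R _).2 ⟨fun x y h => mt (h2 x y h), fun x y h => mt (h1 x y h),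
      compl_subset_compl.2 h3, fun x h => mt (h4 x h)⟩⟩
  imp p q := ⟨(lowerApprox R (p.1.1ᶜ ∪ q.1.1), p.1.1ᶜ ∪ q.1.2), by
    obtain ⟨h1, h2, h3, h4⟩ := (mem_roughSets_iff R _).1 p.2
    obtain ⟨k1, k2, k3, k4⟩ := (mem_roughSets_iff R _).1 q.2
    refine (mem_roughSets_iff R _).2 ⟨fun x y h hx z hz => hx z (trans_of R h hz),
      fun x y h => Or.imp (mt (h1 x y h)) (k2 x y h),
      fun x hx => (hx x (refl_of R x)).imp id (@k3 x), fun x h hx y hy => ?_⟩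
    rw [h y hy]
    exact hx.imp id (k4 x h)⟩
  sneg_sneg p := by
    apply Subtype.ext
    simp
  le_iff_sneg_le p q :=
    ⟨fun h => ⟨compl_subset_compl.2 h.2, compl_subset_compl.2 h.1⟩,
      fun h => ⟨compl_subset_compl.1 h.2, compl_subset_compl.1 h.1⟩⟩
  inf_sneg_le p q := by
    have hp : p.1.1 ⊆ p.1.2 := ((mem_roughSets_iff R _).1 p.2).2.2.1
    have hq : q.1.1 ⊆ q.1.2 := ((mem_roughSets_iff R _).1 q.2).2.2.1
    refine ⟨fun x hx => (hx.2 (hp hx.1)).elim, fun x _ => ?_⟩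
    by_cases h : x ∈ q.1.2
    exacts [Or.inl h, Or.inr fun h' => h (hq h')]
  le_imp_iff p q r := by
    have hp : p.1.1 ⊆ p.1.2 := ((mem_roughSets_iff R _).1 p.2).2.2.1
    have hr := (mem_roughSets_iff R _).1 r.2
    constructor
    · rintro ⟨h1, h2⟩
      refine ⟨fun x hx y hy => ?_, fun x hx => ?_⟩
      · by_cases hy1 : y ∈ p.1.1
        · rcases h1 (show y ∈ p.1.1 ∩ r.1.1 from ⟨hy1, hr.1 x y hy hx⟩) with h | h
          exacts [(h (hp hy1)).elim, Or.inr h]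
        · exact Or.inl hy1
      · by_cases hx1 : x ∈ p.1.1
        · exact h2 (show x ∈ p.1.2 ∩ r.1.2 from ⟨hp hx1, hx⟩)
        · exact Or.inl hx1
    · rintro ⟨h1, h2⟩
      refine ⟨fun x hx => ?_, fun x hx => h2 hx.2⟩
      rcases h1 hx.2 x (refl_of R x) with h | h
      exacts [(h hx.1).elim, Or.inr h]
  inf_imp p q r := by
    apply Subtype.ext
    refine Prod.ext ?_ ?_
    · ext x
      constructor
      · intro h y hy
        by_cases hyp : y ∈ p.1.1
        · refine Or.inr fun z hz => ?_
          have hzp := ((mem_roughSets_iff R _).1 p.2).1 y z hz hyp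
          rcases h z (trans_of R hy hz) with h' | h'
          exacts [Or.inl fun hq => h' ⟨hzp, hq⟩, Or.inr h']
        · exact Or.inl hyp
      · intro h y hy
        rcases h y hy with h' | h'
        · exact Or.inl fun hq => h' hq.1
        · exact (h' y (refl_of R y)).imp (fun hq hpq => hq hpq.2) id
    · change (p.1.1 ∩ q.1.1)ᶜ ∪ r.1.2 = p.1.1ᶜ ∪ (q.1.1ᶜ ∪ r.1.2)
      rw [compl_inter, union_assoc]

end Rough

/-! ## Monteiro spaces -/

/-- A Monteiro space `(X, ≤, g)`. -/
class MonteiroSpace (X : Type u) [PartialOrder X] where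
  g : X → X
  antitone_g : ∀ x y, x ≤ y → g y ≤ g x
  g_g : ∀ x, g (g x) = x
  le_or_le : ∀ x, x ≤ g x ∨ g x ≤ x
  interpolation : ∀ x y, x ≤ g x → x ≤ g y → y ≤ g x → y ≤ g y →
    ∃ z, x ≤ z ∧ y ≤ z ∧ z ≤ g x ∧ z ≤ g y

/-- An isomorphism of Monteiro spaces: an order isomorphism that commutes with `g`. -/
structure MonteiroIso (X Y : Type u) [PartialOrder X] [MonteiroSpace X]
    [PartialOrder Y] [MonteiroSpace Y] extends X ≃o Y where
  map_g : ∀ x, toFun (MonteiroSpace.g x) = MonteiroSpace.g (toFun x)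

/-- The lattice of upsets of `X`, ordered by inclusion; these are exactly the open sets of `X`
with its upper set topology. -/
abbrev Upsets (X : Type u) [PartialOrder X] : Type u := Opens (WithUpperSet X)

theorem mem_upsets_of_le {X : Type u} [PartialOrder X] (A : Upsets X) {x y : X} (h : x ≤ y)
    (hx : WithUpperSet.toUpperSet x ∈ A) : WithUpperSet.toUpperSet y ∈ A :=
  (show IsUpperSet (A : Set (WithUpperSet X)) from A.2) h hx

/-- The upset `{x | ∀ y ≥ x, p y}`. -/
def upsetInterior {X : Type u} [PartialOrder X] (p : X → Prop) : Upsets X :=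
  ⟨{x | ∀ y, WithUpperSet.ofUpperSet x ≤ y → p y}, fun _ _ h hx z hz => hx z (le_trans h hz)⟩

/-- The Nelson algebra of upsets of a Monteiro space:
`∼A = {x | g x ∉ A}` and `A → B = {x | ∀ y ≥ x, y ∈ A → y ∈ ∼A ∪ B}`. -/
instance (X : Type u) [PartialOrder X] [MonteiroSpace X] : NelsonAlgebra (Upsets X) where
  sneg A := ⟨{x | WithUpperSet.toUpperSet (MonteiroSpace.g (WithUpperSet.ofUpperSet x)) ∉ A},
    fun _ _ h hx hy => hx (mem_upsets_of_le A (MonteiroSpace.antitone_g _ _ h) hy)⟩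
  imp A B := upsetInterior fun y => WithUpperSet.toUpperSet y ∈ A →
    WithUpperSet.toUpperSet (MonteiroSpace.g y) ∉ A ∨ WithUpperSet.toUpperSet y ∈ B
  sneg_sneg A := by
    ext x
    let a : X → Prop := fun y => WithUpperSet.toUpperSet y ∈ A
    change ¬ ¬ a (MonteiroSpace.g (MonteiroSpace.g (WithUpperSet.ofUpperSet x))) ↔
      a (WithUpperSet.ofUpperSet x)
    rw [not_not, MonteiroSpace.g_g]
  le_iff_sneg_le A B := by
    constructor
    · exact fun h x hx hA => hx (h hA)
    · intro h x hx
      let a : X → Prop := fun y => WithUpperSet.toUpperSet y ∈ A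
      let b : X → Prop := fun y => WithUpperSet.toUpperSet y ∈ B
      have h' : ∀ y : X, ¬ b (MonteiroSpace.g y) → ¬ a (MonteiroSpace.g y) :=
        fun y hy => (show ∀ z, _ → _ from fun z hz => h hz) (WithUpperSet.toUpperSet y) hy
      have h2 := h' (MonteiroSpace.g (WithUpperSet.ofUpperSet x))
      rw [MonteiroSpace.g_g] at h2
      exact not_imp_not.1 h2 hx
  inf_sneg_le A B := by
    rintro x ⟨hA, hgA⟩
    rcases MonteiroSpace.le_or_le (X := X) x with h | h
    · exact (hgA (mem_upsets_of_le A h hA)).elim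
    · by_cases hB : x ∈ B
      · exact Or.inl hB
      · exact Or.inr fun h' => hB (mem_upsets_of_le B h h')
  le_imp_iff A B C := by
    constructor
    · intro h x hx y hy hyA
      exact h ⟨hyA, mem_upsets_of_le C hy hx⟩
    · rintro h x ⟨hA, hC⟩
      exact h hC x (le_refl (α := X) x) hA
  inf_imp A B C := by
    let a : Set X := {y | WithUpperSet.toUpperSet y ∈ A}
    let b : Set X := {y | WithUpperSet.toUpperSet y ∈ B}
    let c : Set X := {y | WithUpperSet.toUpperSet y ∈ C}
    have upA : ∀ {x y : X}, x ≤ y → x ∈ a → y ∈ a := fun h hx => mem_upsets_of_le A h hx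
    have upB : ∀ {x y : X}, x ≤ y → x ∈ b → y ∈ b := fun h hx => mem_upsets_of_le B h hx
    have upC : ∀ {x y : X}, x ≤ y → x ∈ c → y ∈ c := fun h hx => mem_upsets_of_le C h hx
    have anti := MonteiroSpace.antitone_g (X := X)
    have gg := MonteiroSpace.g_g (X := X)
    let γ : X → X := MonteiroSpace.g
    ext x
    change (∀ y : X, x ≤ y → y ∈ a ∩ b → ¬ γ y ∈ a ∩ b ∨ y ∈ c) ↔
      ∀ y : X, x ≤ y → y ∈ a → ¬ γ y ∈ a ∨
        ∀ z : X, y ≤ z → z ∈ b → ¬ γ z ∈ b ∨ z ∈ c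
    constructor
    · intro h y hxy hyA
      refine or_iff_not_imp_left.2 fun hgy z hyz hzB => or_iff_not_imp_left.2 fun hgz => ?_
      rw [not_not] at hgy hgz
      have use : ∀ v : X, x ≤ v → v ≤ z → v ∈ a → v ∈ b →
          γ v ∈ a → γ v ∈ b → z ∈ c := fun v h1 h2 h3 h4 h5 h6 =>
        upC h2 ((h v h1 ⟨h3, h4⟩).resolve_left (not_not.2 ⟨h5, h6⟩))
      have hzy : γ z ≤ γ y := anti _ _ hyz
      rcases MonteiroSpace.le_or_le (X := X) z with hz | hz
      · exact use z (le_trans (α := X) hxy hyz) (le_refl (α := X) z) (upA hyz hyA) hzB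
          (upA hz (upA hyz hyA)) hgz
      · rcases MonteiroSpace.le_or_le (X := X) y with hy | hy
        · have e : MonteiroSpace.g (γ z) = z := gg z
          obtain ⟨v, h1, h2, h3, h4⟩ := MonteiroSpace.interpolation (X := X) y (γ z) hy
            (e.symm ▸ hyz) hzy (e.symm ▸ hz)
          rw [e] at h4
          have hv1 : γ z ≤ γ v := anti _ _ h4
          have hv2 : y ≤ γ v := gg y ▸ anti _ _ h3
          exact use v (le_trans (α := X) hxy h1) h4 (upA h1 hyA) (upB h2 hgz) (upA hv2 hyA)
            (upB hv1 hgz)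
        · exact use y hxy hyz hyA (upB hy (upB hzy hgz)) hgy (upB hzy hgz)
    · rintro h y hxy ⟨hyA, hyB⟩
      by_contra! hc
      rcases h y hxy hyA with h' | h'
      · exact h' hc.1.1
      · exact (h' y (le_refl (α := X) y) hyB).elim (fun h'' => h'' hc.1.2) hc.2

/-! ## Completely join-irreducible elements -/

/-- `j` is completely join-irreducible: if `j` is the join of `S`, then `j ∈ S`. -/
def IsCompletelyJoinIrreducible {A : Type u} [PartialOrder A] (j : A) : Prop :=
  ∀ S : Set A, IsLUB S j → j ∈ S

/-- The completely join-irreducible elements of `A`, ordered by `i ◁ j ↔ j ≤ i`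
(the dual of the order of `A`). -/
abbrev JoinIrreducibles (A : Type u) [PartialOrder A] : Type u :=
  {j : A // IsCompletelyJoinIrreducible j}ᵒᵈ

/-- A completely join-irreducible element, as an element of `A`. -/
def JoinIrreducibles.val {A : Type u} [PartialOrder A] (j : JoinIrreducibles A) : A :=
  (OrderDual.ofDual j).1

/-! ## Isomorphisms of Nelson algebras on topologies -/

/-- An isomorphism between Nelson algebras on the topologies of `X` and `Y` that is induced by
the points: a homeomorphism whose direct image map on open sets preserves `∼` and `→`
(it preserves `∪`, `∩`, `∅` and the whole space anyway). -/
structure TopologicalNelsonIso (X Y : Type u) [TopologicalSpace X] [NelsonAlgebra (Opens X)]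
    [TopologicalSpace Y] [NelsonAlgebra (Opens Y)] extends X ≃ₜ Y where
  map_sneg : ∀ S : Opens X,
    toHomeomorph.opensCongr (sneg S) = sneg (toHomeomorph.opensCongr S)
  map_imp : ∀ S T : Opens X, toHomeomorph.opensCongr (imp S T) =
    imp (toHomeomorph.opensCongr S) (toHomeomorph.opensCongr T)

/-! ## Isomorphisms of Nelson algebras and order isomorphisms -/

section Iso

variable {A B C : Type u} [DistribLattice A] [BoundedOrder A] [NelsonAlgebra A]
  [DistribLattice B] [BoundedOrder B] [NelsonAlgebra B]
  [DistribLattice C] [BoundedOrder C] [NelsonAlgebra C]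

/-- The order isomorphism underlying an isomorphism of Nelson algebras. -/
def NelsonIso.toOrderIso (e : NelsonIso A B) : A ≃o B where
  toEquiv := e.toEquiv
  map_rel_iff' {a b} := by
    change e.toFun a ≤ e.toFun b ↔ a ≤ b
    rw [← inf_eq_left, ← inf_eq_left, ← e.map_inf]
    exact e.toEquiv.injective.eq_iff

/-- An order isomorphism that preserves `∼` is an isomorphism of Nelson algebras, because `→` is
determined by the order and `∼`. -/
def NelsonIso.ofOrderIso (e : A ≃o B) (h : ∀ a, e (sneg a) = sneg (e a)) : NelsonIso A B where
  toEquiv := e.toEquiv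
  map_sup := e.map_sup
  map_inf := e.map_inf
  map_sneg := h
  map_bot := e.map_bot
  map_top := e.map_top
  map_imp a b := by
    change e (imp a b) = imp (e a) (e b)
    refine eq_of_forall_le_iff fun c => ?_
    rw [← NelsonAlgebra.le_imp_iff, ← e.symm_apply_le, ← NelsonAlgebra.le_imp_iff,
      ← e.le_iff_le, e.map_inf, e.map_sup, h, e.apply_symm_apply]

theorem nelsonIsomorphic_iff :
    A ≅ₙ B ↔ ∃ e : A ≃o B, ∀ a, e (sneg a) = sneg (e a) :=
  ⟨fun ⟨e⟩ => ⟨e.toOrderIso, e.map_sneg⟩, fun ⟨e, h⟩ => ⟨.ofOrderIso e h⟩⟩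

theorem NelsonIsomorphic.trans (h₁ : A ≅ₙ B) (h₂ : B ≅ₙ C) : A ≅ₙ C := by
  obtain ⟨e, he⟩ := nelsonIsomorphic_iff.1 h₁
  obtain ⟨f, hf⟩ := nelsonIsomorphic_iff.1 h₂
  exact nelsonIsomorphic_iff.2 ⟨e.trans f, fun a => by simp [he, hf]⟩

theorem sneg_le_iff {a b : A} : sneg a ≤ b ↔ sneg b ≤ a := by
  rw [NelsonAlgebra.le_iff_sneg_le, NelsonAlgebra.sneg_sneg]

theorem le_sneg_iff {a b : A} : a ≤ sneg b ↔ b ≤ sneg a := by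
  rw [NelsonAlgebra.le_iff_sneg_le, NelsonAlgebra.sneg_sneg]

end Iso

/-! ## A criterion for algebraic lattices -/

/-- A partial order whose elements are separated by a family of points is an algebraic lattice if
suprema exist and are computed pointwise and every point lies in a least element. -/
theorem isAlgebraicLattice_of_points {L ι : Type*} [PartialOrder L] (mem : ι → L → Prop)
    (le_iff : ∀ a b, a ≤ b ↔ ∀ i, mem i a → mem i b)
    (exists_sup : ∀ s : Set L, ∃ a, ∀ i, mem i a ↔ ∃ b ∈ s, mem i b)
    (least : ι → L) (least_le_iff : ∀ i a, least i ≤ a ↔ mem i a) :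
    IsAlgebraicLattice L := by
  have isLUB : ∀ (s : Set L) a, (∀ i, mem i a ↔ ∃ b ∈ s, mem i b) → IsLUB s a :=
    fun s a ha => ⟨fun b hb => (le_iff _ _).2 fun i hi => (ha i).2 ⟨b, hb, hi⟩,
      fun u hu => (le_iff _ _).2 fun i hi => by
        obtain ⟨b, hb, hib⟩ := (ha i).1 hi
        exact (le_iff _ _).1 (hu hb) i hib⟩
  refine ⟨fun s => (exists_sup s).imp (isLUB s), fun a => ⟨least '' {i | mem i a}, ?_, ?_⟩⟩
  · rintro _ ⟨i, -, rfl⟩ s v - - hv hi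
    obtain ⟨w, hw⟩ := exists_sup s
    obtain rfl := hv.unique (isLUB s w hw)
    obtain ⟨b, hb, hib⟩ := (hw i).1 ((least_le_iff _ _).1 hi)
    exact ⟨b, hb, (least_le_iff _ _).2 hib⟩
  · refine isLUB _ _ fun i => ⟨fun hi => ⟨_, ⟨i, hi, rfl⟩, (least_le_iff _ _).1 le_rfl⟩, ?_⟩
    rintro ⟨_, ⟨k, hk, rfl⟩, hi⟩
    exact (le_iff _ _).1 ((least_le_iff _ _).2 hk) i hi

/-! ## Rough sets -/

/-- The rough sets induced by a quasiorder form an algebraic lattice. -/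
theorem isAlgebraicLattice_roughSet {U : Type u} (R : U → U → Prop) [IsPreorder U R] :
    IsAlgebraicLattice (RoughSet R) := by
  have prop : ∀ p : RoughSet R, _ := fun p => (mem_roughSets_iff R p.1).1 p.2
  have tr : ∀ {x y z}, R x y → R y z → R x z := fun h h' => trans_of R h h'
  have rfl' : ∀ x, R x x := fun x => refl_of R x
  refine isAlgebraicLattice_of_points (ι := U ⊕ U)
    (fun i p => Sum.elim (· ∈ p.1.1) (· ∈ p.1.2) i) (fun p q => ?_) (fun s => ?_)
    (Sum.elim
      (fun x => ⟨({y | R x y}, {y | ∃ z, R x z ∧ R y z}), (mem_roughSets_iff R _).2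
        ⟨fun y z h hy => tr hy h, fun y z h ⟨w, hw, hz⟩ => ⟨w, hw, tr h hz⟩,
          fun y hy => ⟨y, hy, rfl' y⟩, fun y h ⟨z, hz, hy⟩ => h z hy ▸ hz⟩⟩)
      (fun x => ⟨({y | y = x ∧ ∀ z, R x z → z = x}, {y | R y x}), (mem_roughSets_iff R _).2
        ⟨fun y z h ⟨hy, hx⟩ => ⟨hx z (hy ▸ h), hx⟩, fun y z h hz => tr h hz,
          fun y hy => hy.1 ▸ rfl' y, fun y h hy => by
            obtain rfl := h x hy
            exact ⟨rfl, h⟩⟩⟩))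
    ?_
  · exact ⟨fun h i => i.casesOn (fun x hx => h.1 hx) (fun x hx => h.2 hx),
      fun h => ⟨fun x hx => h (.inl x) hx, fun x hx => h (.inr x) hx⟩⟩
  · refine ⟨⟨({x | ∃ b ∈ s, x ∈ b.1.1}, {x | ∃ b ∈ s, x ∈ b.1.2}), (mem_roughSets_iff R _).2
      ⟨?_, ?_, ?_, ?_⟩⟩, ?_⟩
    · rintro x y h ⟨b, hb, hx⟩
      exact ⟨b, hb, (prop b).1 x y h hx⟩
    · rintro x y h ⟨b, hb, hx⟩
      exact ⟨b, hb, (prop b).2.1 x y h hx⟩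
    · rintro x ⟨b, hb, hx⟩
      exact ⟨b, hb, (prop b).2.2.1 hx⟩
    · rintro x h ⟨b, hb, hx⟩
      exact ⟨b, hb, (prop b).2.2.2 x h hx⟩
    · rintro (x | x) <;> exact Iff.rfl
  · rintro (x | x) p <;> obtain ⟨h1, h2, h3, h4⟩ := prop p
    · exact ⟨fun h => h.1 (rfl' x), fun h => ⟨fun y hy => h1 x y hy h,
        fun y ⟨z, hz, hy⟩ => h2 y z hy (h3 (h1 x z hz h))⟩⟩
    · refine ⟨fun h => h.2 (rfl' x), fun h => ⟨?_, fun y hy => h2 y x hy h⟩⟩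
      rintro y ⟨rfl, hy⟩
      exact h4 y hy h

/-- The Nelson algebra of a Monteiro space is one of rough sets induced by a quasiorder on its
points. -/
theorem exists_upsets_nelsonIsomorphic_roughSet (X : Type u) [PartialOrder X] [MonteiroSpace X] :
    ∃ (R : X → X → Prop) (_ : IsPreorder X R), Upsets X ≅ₙ RoughSet R := by
  classical
  obtain ⟨g, anti, gg, comparable, interp, hgdef⟩ : ∃ g : X → X, (∀ x y, x ≤ y → g y ≤ g x) ∧
      (∀ x, g (g x) = x) ∧ (∀ x, x ≤ g x ∨ g x ≤ x) ∧ (∀ x y, x ≤ g x → x ≤ g y → y ≤ g x →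
        y ≤ g y → ∃ z, x ≤ z ∧ y ≤ z ∧ z ≤ g x ∧ z ≤ g y) ∧ g = MonteiroSpace.g :=
    ⟨_, MonteiroSpace.antitone_g, MonteiroSpace.g_g, MonteiroSpace.le_or_le,
      MonteiroSpace.interpolation, rfl⟩
  obtain ⟨ρ, hρ, hρ'⟩ : ∃ ρ : X → X, (∀ x, g (ρ x) ≤ ρ x) ∧ ∀ x, ρ x = x ∧ g x ≤ x ∨
      ρ x = g x ∧ x ≤ g x := by
    refine ⟨fun x => if g x ≤ x then x else g x, fun x => ?_, fun x => ?_⟩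
    · by_cases h : g x ≤ x
      · simp [h]
      · simp [h, gg, (comparable x).resolve_right h]
    · by_cases h : g x ≤ x
      · simp [h]
      · simpa [h] using (comparable x).resolve_right h
  have ρ_of : ∀ x, g x ≤ x → ρ x = x := fun x h => by
    rcases hρ' x with h' | h'
    exacts [h'.1, h'.1.trans (h.antisymm h'.2)]
  have ρ_of' : ∀ x, x ≤ g x → ρ x = g x := fun x h => by
    rcases hρ' x with h' | h'
    exacts [h'.1.trans (h.antisymm h'.2), h'.1]
  have ρρ : ∀ x, ρ (ρ x) = ρ x := fun x => ρ_of _ (hρ x)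
  have ρgρ : ∀ x, ρ (g (ρ x)) = ρ x := fun x => by
    rw [ρ_of' _ (by rw [gg]; exact hρ x), gg]
  let R : X → X → Prop := fun x y => ρ y ≤ ρ x
  have hR : IsPreorder X R :=
    { refl := fun x => le_refl (ρ x), trans := fun x y z h h' => le_trans h' h }
  refine ⟨R, hR, nelsonIsomorphic_iff.2 ?_⟩
  have up : ∀ (S : Upsets X) {x y : X}, x ≤ y → WithUpperSet.toUpperSet x ∈ S →
      WithUpperSet.toUpperSet y ∈ S := fun S _ _ h hx => mem_upsets_of_le S h hx
  let F : Upsets X → RoughSet R := fun S =>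
    ⟨({x | WithUpperSet.toUpperSet (g (ρ x)) ∈ S}, {x | WithUpperSet.toUpperSet (ρ x) ∈ S}),
      (mem_roughSets_iff R _).2 ⟨fun x y h => up S (anti _ _ h), fun x y h => up S h,
        fun x => up S (hρ x), fun x h hx => by
          have h1 : ρ x = x := h _ (ρρ x).le
          have h2 : g (ρ x) = x := h _ (ρgρ x).le
          change WithUpperSet.toUpperSet (g (ρ x)) ∈ S
          rw [h2, ← h1]
          exact hx⟩⟩
  have hF : ∀ S T, F S ≤ F T ↔ S ≤ T := by
    refine fun S T => ⟨fun h (x : X) hx => ?_, fun h => ⟨fun x hx => h hx, fun x hx => h hx⟩⟩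
    rcases hρ' x with h' | h'
    · have := @h.2 x
      change WithUpperSet.toUpperSet (ρ x) ∈ S → WithUpperSet.toUpperSet (ρ x) ∈ T at this
      rw [h'.1] at this
      exact this hx
    · have := @h.1 x
      change WithUpperSet.toUpperSet (g (ρ x)) ∈ S → WithUpperSet.toUpperSet (g (ρ x)) ∈ T at this
      rw [h'.1, gg] at this
      exact this hx
  have surj : Function.Surjective F := by
    intro p
    obtain ⟨h1, h2, h3, h4⟩ := (mem_roughSets_iff R _).1 p.2
    have up : IsUpperSet {x : X | g x ≤ x ∧ x ∈ p.1.2 ∨ x ≤ g x ∧ x ∈ p.1.1} := by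
      rintro x y hxy (⟨hx, hx'⟩ | ⟨hx, hx'⟩)
      · have hy : g y ≤ y := (anti _ _ hxy).trans (hx.trans hxy)
        exact .inl ⟨hy, h2 y x (by change ρ x ≤ ρ y; rwa [ρ_of x hx, ρ_of y hy]) hx'⟩
      · rcases comparable y with hy | hy
        · refine .inr ⟨hy, h1 x y ?_ hx'⟩
          change ρ y ≤ ρ x
          rw [ρ_of' x hx, ρ_of' y hy]
          exact anti _ _ hxy
        · obtain ⟨z, hz1, hz2, hz3, hz4⟩ := interp x (g y) hx (by rwa [gg]) (anti _ _ hxy)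
            (by rwa [gg])
          rw [gg] at hz4
          have hz : ρ z ≤ g x ∧ ρ z ≤ y := by
            rcases hρ' z with h | h <;> rw [h.1]
            exacts [⟨hz3, hz4⟩, ⟨anti _ _ hz1, gg y ▸ anti _ _ hz2⟩]
          refine .inl ⟨hy, h2 y z ?_ (h3 (h1 x z ?_ hx'))⟩
          · change ρ z ≤ ρ y
            rw [ρ_of y hy]
            exact hz.2
          · change ρ z ≤ ρ x
            rw [ρ_of' x hx]
            exact hz.1
    refine ⟨⟨_, up⟩, Subtype.ext (Prod.ext (Set.ext fun x => ?_) (Set.ext fun x => ?_))⟩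
    · change (g (g (ρ x)) ≤ g (ρ x) ∧ g (ρ x) ∈ p.1.2 ∨ g (ρ x) ≤ g (g (ρ x)) ∧ g (ρ x) ∈ p.1.1) ↔ _
      rw [gg]
      refine ⟨?_, fun hx => .inr ⟨hρ x, h1 x _ (ρgρ x).le hx⟩⟩
      rintro (⟨h, hx⟩ | ⟨-, hx⟩)
      · have e : ρ x = g (ρ x) := h.antisymm (hρ x)
        have hmax : ∀ y, ρ y ≤ ρ x → y = ρ x := fun y hy => by
          have e' : ρ y = ρ x := hy.antisymm (by
            calc ρ x = g (ρ x) := e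
              _ ≤ g (ρ y) := anti _ _ hy
              _ ≤ ρ y := hρ y)
          rcases hρ' y with h' | h'
          · rw [← e', h'.1]
          · rw [e, ← e', h'.1, gg]
        obtain hx' : x = ρ x := hmax x le_rfl
        rw [← e, ← hx'] at hx
        exact h4 x (fun y hy => (hmax y hy).trans hx'.symm) hx
      · exact h1 _ x (ρgρ x).ge hx
    · change (g (ρ x) ≤ ρ x ∧ ρ x ∈ p.1.2 ∨ ρ x ≤ g (ρ x) ∧ ρ x ∈ p.1.1) ↔ _
      refine ⟨?_, fun hx => .inl ⟨hρ x, h2 _ x (ρρ x).ge hx⟩⟩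
      rintro (⟨-, hx⟩ | ⟨-, hx⟩)
      exacts [h2 x _ (ρρ x).le hx, h2 x _ (ρρ x).le (h3 hx)]
  refine ⟨{ Equiv.ofBijective F ⟨fun S T h => ((hF S T).1 h.le).antisymm ((hF T S).1 h.ge), surj⟩
    with map_rel_iff' := fun {S T} => hF S T }, fun S => ?_⟩
  refine Subtype.ext (Prod.ext (Set.ext fun x => ?_) (Set.ext fun x => ?_))
  · change ¬ WithUpperSet.toUpperSet (MonteiroSpace.g (g (ρ x))) ∈ S ↔
      ¬ WithUpperSet.toUpperSet (ρ x) ∈ S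
    rw [← hgdef, gg]
  · change ¬ WithUpperSet.toUpperSet (MonteiroSpace.g (ρ x)) ∈ S ↔
      ¬ WithUpperSet.toUpperSet (g (ρ x)) ∈ S
    rw [← hgdef]

/-! ## Alexandrov topologies -/

section Alexandrov

variable {X Y : Type u} [TopologicalSpace X] [AlexandrovDiscrete X] [TopologicalSpace Y]
  [AlexandrovDiscrete Y]

/-- The least open set containing `x`. -/
def leastOpen (x : X) : Opens X := ⟨nhdsKer {x}, isOpen_nhdsKer⟩

theorem leastOpen_le_iff {x : X} {S : Opens X} : leastOpen x ≤ S ↔ x ∈ S :=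
  (S.isOpen.nhdsKer_subset).trans singleton_subset_iff

theorem leastOpen_injective [T0Space X] : Function.Injective (leastOpen : X → Opens X) :=
  fun x y h => (inseparable_iff_forall_isOpen.2 fun S hS => by
    have := leastOpen_le_iff (x := x) (S := ⟨S, hS⟩)
    rw [h, leastOpen_le_iff] at this
    exact this.symm).eq

theorem isCompletelyJoinIrreducible_opens_iff {S : Opens X} :
    IsCompletelyJoinIrreducible S ↔ ∃ x, leastOpen x = S := by
  constructor
  · intro h
    obtain ⟨x, -, hx⟩ := h (leastOpen '' S) ⟨by
      rintro _ ⟨x, hx, rfl⟩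
      exact leastOpen_le_iff.2 hx, fun T hT x hx => leastOpen_le_iff.1 (hT ⟨x, hx, rfl⟩)⟩
    exact ⟨x, hx⟩
  · rintro ⟨x, rfl⟩ s hs
    have hx : x ∈ sSup s := by
      rw [hs.sSup_eq]
      exact leastOpen_le_iff.1 le_rfl
    obtain ⟨T, hT, hxT⟩ := Opens.mem_sSup.1 hx
    rwa [← (hs.1 hT).antisymm (leastOpen_le_iff.2 hxT)]

/-- The open sets of an Alexandrov topology form an algebraic lattice. -/
theorem isAlgebraicLattice_opens (X : Type u) [TopologicalSpace X] [AlexandrovDiscrete X] :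
    IsAlgebraicLattice (Opens X) :=
  isAlgebraicLattice_of_points (fun (x : X) S => x ∈ S) (fun _ _ => Iff.rfl)
    (fun s => ⟨sSup s, fun _ => Opens.mem_sSup⟩) leastOpen fun _ _ => leastOpen_le_iff

theorem IsCompletelyJoinIrreducible.map {A B : Type u} [PartialOrder A] [PartialOrder B]
    {a : A} (h : IsCompletelyJoinIrreducible a) (e : A ≃o B) :
    IsCompletelyJoinIrreducible (e a) := fun s hs => by
  have : IsLUB (e ⁻¹' s) a := by
    rw [e.isLUB_preimage]
    exact hs
  exact h _ this

/-- An isomorphism between the lattices of open sets of Alexandrov `T₀` spaces is induced by a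
homeomorphism. -/
theorem exists_homeomorph_of_opens_orderIso [T0Space X] [T0Space Y] (e : Opens X ≃o Opens Y) :
    ∃ f : X ≃ₜ Y, ∀ S x, f x ∈ e S ↔ x ∈ S := by
  have hf : ∀ x : X, ∃ y, leastOpen y = e (leastOpen x) := fun x =>
    isCompletelyJoinIrreducible_opens_iff.1
      ((isCompletelyJoinIrreducible_opens_iff.2 ⟨x, rfl⟩).map e)
  have hg : ∀ y : Y, ∃ x, leastOpen x = e.symm (leastOpen y) := fun y =>
    isCompletelyJoinIrreducible_opens_iff.1
      ((isCompletelyJoinIrreducible_opens_iff.2 ⟨y, rfl⟩).map e.symm)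
  choose f hf using hf
  choose g hg using hg
  have mem : ∀ S x, f x ∈ e S ↔ x ∈ S := fun S x => by
    rw [← leastOpen_le_iff, hf, e.le_iff_le, leastOpen_le_iff]
  have gf : Function.LeftInverse g f := fun x => leastOpen_injective (by
    rw [hg, hf, e.symm_apply_apply])
  have fg : Function.RightInverse g f := fun y => leastOpen_injective (by
    rw [hf, hg, e.apply_symm_apply])
  refine ⟨⟨⟨f, g, gf, fg⟩, ⟨fun T hT => ?_⟩, ⟨fun S hS => ?_⟩⟩, mem⟩
  · convert (e.symm ⟨T, hT⟩).isOpen using 1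
    ext x
    change f x ∈ (⟨T, hT⟩ : Opens Y) ↔ x ∈ e.symm ⟨T, hT⟩
    rw [← mem, e.apply_symm_apply]
  · convert (e ⟨S, hS⟩).isOpen using 1
    ext y
    change g y ∈ (⟨S, hS⟩ : Opens X) ↔ y ∈ e ⟨S, hS⟩
    rw [← mem, fg]

/-- A Nelson algebra on an Alexandrov `T₀` topology determines the space. -/
theorem opens_nelsonIsomorphic_iff [T0Space X] [T0Space Y] [NelsonAlgebra (Opens X)]
    [NelsonAlgebra (Opens Y)] :
    Opens X ≅ₙ Opens Y ↔ Nonempty (TopologicalNelsonIso X Y) := by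
  constructor
  · rintro ⟨e⟩
    obtain ⟨f, hf⟩ := exists_homeomorph_of_opens_orderIso e.toOrderIso
    have he : ∀ S, f.opensCongr S = e.toFun S := fun S => by
      ext y
      obtain ⟨x, rfl⟩ := f.surjective y
      change f.symm (f x) ∈ S ↔ f x ∈ e.toOrderIso S
      rw [hf, f.symm_apply_apply]
    exact ⟨⟨f, fun S => by rw [he, he, e.map_sneg], fun S T => by rw [he, he, he, e.map_imp]⟩⟩
  · rintro ⟨f⟩
    exact nelsonIsomorphic_iff.2 ⟨f.toHomeomorph.opensCongr, f.map_sneg⟩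

end Alexandrov

/-! ## Monteiro spaces -/

instance (X : Type u) [PartialOrder X] : T0Space (WithUpperSet X) :=
  ⟨fun x y h => by
    have h1 : y ≤ x := IsUpperSet.specializes_iff_le.1 h.specializes
    have h2 : x ≤ y := IsUpperSet.specializes_iff_le.1 h.specializes'
    exact le_antisymm (α := X) h2 h1⟩

section Monteiro

variable {X Y : Type u} [PartialOrder X] [MonteiroSpace X] [PartialOrder Y] [MonteiroSpace Y]

theorem mem_sneg_upsets {S : Upsets X} {x : X} : WithUpperSet.toUpperSet x ∈ sneg S ↔
    WithUpperSet.toUpperSet (MonteiroSpace.g x) ∉ S := Iff.rfl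

/-- A Monteiro space is determined by its Nelson algebra. -/
theorem upsets_nelsonIsomorphic_iff : Upsets X ≅ₙ Upsets Y ↔ Nonempty (MonteiroIso X Y) := by
  rw [nelsonIsomorphic_iff]
  constructor
  · rintro ⟨e, he⟩
    obtain ⟨f, hf⟩ := exists_homeomorph_of_opens_orderIso e
    have hle : ∀ x y : WithUpperSet X, f x ≤ f y ↔ x ≤ y := fun x y => by
      rw [← IsUpperSet.specializes_iff_le, ← IsUpperSet.specializes_iff_le,
        f.isInducing.specializes_iff]
    let f' : X ≃ Y := f.toEquiv
    have hf' : ∀ (S : Upsets X) (x : X), WithUpperSet.toUpperSet (f' x) ∈ e S ↔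
      WithUpperSet.toUpperSet x ∈ S := hf
    refine ⟨⟨⟨f', fun {x y} => hle x y⟩, fun x => ?_⟩⟩
    change WithUpperSet.toUpperSet (f' (MonteiroSpace.g x)) =
      WithUpperSet.toUpperSet (MonteiroSpace.g (f' x))
    refine (inseparable_iff_forall_isOpen.2 fun T hT => ?_).eq
    obtain ⟨S, hS⟩ := e.surjective ⟨T, hT⟩
    change _ ∈ (⟨T, hT⟩ : Upsets Y) ↔ _ ∈ (⟨T, hT⟩ : Upsets Y)
    rw [← hS, hf', ← not_iff_not, ← mem_sneg_upsets, ← mem_sneg_upsets, ← he, hf']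
  · rintro ⟨f⟩
    let F : WithUpperSet X ≃ₜ WithUpperSet Y :=
      ⟨f.toEquiv, IsUpperSet.monotone_iff_continuous.1 (OrderIso.monotone f.toRelIso),
        IsUpperSet.monotone_iff_continuous.1 (OrderIso.monotone f.toRelIso.symm)⟩
    refine ⟨F.opensCongr, fun S => ?_⟩
    ext y
    obtain ⟨x, rfl⟩ := f.toEquiv.surjective y
    have hF : ∀ (S : Upsets X) (x : X), WithUpperSet.toUpperSet (f.toFun x) ∈ F.opensCongr S ↔
        WithUpperSet.toUpperSet x ∈ S := fun S x => by
      change F.symm (F (WithUpperSet.toUpperSet x)) ∈ S ↔ _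
      rw [F.symm_apply_apply]
    refine (hF _ x).trans ?_
    rw [mem_sneg_upsets, ← hF, f.map_g]
    rfl

end Monteiro

/-! ## Nelson algebras on algebraic lattices -/

section Algebraic

variable {A : Type u}

/-- In an algebraic distributive lattice completely join-irreducible elements are completely
join-prime. -/
theorem IsCompletelyJoinIrreducible.exists_le_of_le_isLUB [DistribLattice A] [BoundedOrder A]
    (hA : IsAlgebraicLattice A) {j : A} (hj : IsCompletelyJoinIrreducible j) {s : Set A} {a : A}
    (ha : IsLUB s a) (hja : j ≤ a) : ∃ b ∈ s, j ≤ b := by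
  classical
  suffices IsLUB ((j ⊓ ·) '' s) j by
    obtain ⟨b, hb, h⟩ := hj _ this
    exact ⟨b, hb, inf_eq_left.1 h⟩
  refine ⟨by rintro _ ⟨b, -, rfl⟩; exact inf_le_left, fun w hw => ?_⟩
  obtain ⟨K, hK, hKj⟩ := hA.2 j
  refine hKj.2 fun c hc => ?_
  have hcj : c ≤ j := hKj.1 hc
  obtain ⟨_, ⟨t, hts, rfl⟩, hct⟩ := hK c hc {b | ∃ t : Finset A, (t : Set A) ⊆ s ∧ t.sup id = b} a
    ⟨⊥, ∅, by simp⟩ (by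
      rintro _ ⟨t, ht, rfl⟩ _ ⟨t', ht', rfl⟩
      exact ⟨_, ⟨t ∪ t', by simp [ht, ht'], rfl⟩, Finset.sup_mono Finset.subset_union_left,
        Finset.sup_mono Finset.subset_union_right⟩)
    ⟨by
      rintro _ ⟨t, ht, rfl⟩
      exact Finset.sup_le fun b hb => ha.1 (ht hb),
      fun v hv => ha.2 fun b hb => hv ⟨{b}, by simpa using hb, by simp⟩⟩
    (hcj.trans hja)
  rw [← inf_eq_left.2 hct, Finset.sup_inf_distrib_left]
  exact Finset.sup_le fun b hb => (inf_le_inf_right _ hcj).trans (hw ⟨b, hts hb, rfl⟩)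

theorem IsCompletelyJoinIrreducible.le_sup_iff [DistribLattice A] [BoundedOrder A]
    (hA : IsAlgebraicLattice A) {j a b : A} (hj : IsCompletelyJoinIrreducible j) :
    j ≤ a ⊔ b ↔ j ≤ a ∨ j ≤ b := by
  refine ⟨fun h => ?_, fun h => h.elim (le_sup_of_le_left ·) (le_sup_of_le_right ·)⟩
  obtain ⟨c, rfl | rfl, hc⟩ := hj.exists_le_of_le_isLUB hA isLUB_pair h
  exacts [.inl hc, .inr hc]

/-- In an algebraic lattice, an element not below `y` is not below some element above `y` which is
not the meet of elements different from it. -/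
theorem IsAlgebraicLattice.exists_meetIrreducible [PartialOrder A] (hA : IsAlgebraicLattice A)
    {x y : A} (hxy : ¬ x ≤ y) :
    ∃ m, y ≤ m ∧ ¬ x ≤ m ∧ ∀ S : Set A, IsGLB S m → m ∈ S := by
  obtain ⟨K, hK, hKx⟩ := hA.2 x
  obtain ⟨c, hc, hcy⟩ : ∃ c ∈ K, ¬ c ≤ y := by
    by_contra! h
    exact hxy (hKx.2 h)
  obtain ⟨m, hym, hm⟩ := zorn_le_nonempty₀ {z | ¬ c ≤ z} (fun C hC hch z hz => by
    obtain ⟨w, hw⟩ := hA.1 C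
    refine ⟨w, fun hcw => ?_, hw.1⟩
    obtain ⟨b, hb, hcb⟩ := hK c hc C w ⟨z, hz⟩ hch.directedOn hw hcw
    exact hC hb hcb) y hcy
  refine ⟨m, hym, fun h => hm.1 ((hKx.1 hc).trans h), fun S hS => ?_⟩
  by_contra hmS
  refine hm.1 (hS.2 fun b hb => ?_)
  by_contra hcb
  have hmb := hS.1 hb
  exact hmS (hmb.antisymm (hm.2 hcb hmb) ▸ hb)

variable [DistribLattice A] [BoundedOrder A] [NelsonAlgebra A]

theorem isCompletelyJoinIrreducible_sneg {m : A} (hm : ∀ S : Set A, IsGLB S m → m ∈ S) :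
    IsCompletelyJoinIrreducible (sneg m) := fun S hS => by
  have : IsGLB (sneg ⁻¹' S) m :=
    ⟨fun b hb => (NelsonAlgebra.le_iff_sneg_le _ _).2 (hS.1 hb), fun w hw =>
      (NelsonAlgebra.le_iff_sneg_le _ _).2 (hS.2 fun b hb =>
        le_sneg_iff.2 (hw (by rwa [mem_preimage, NelsonAlgebra.sneg_sneg])))⟩
  exact hm _ this

/-- A Nelson algebra on an algebraic lattice is generated by its completely join-irreducible
elements. -/
theorem IsAlgebraicLattice.le_of_forall_joinIrreducible (hA : IsAlgebraicLattice A) {a b : A}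
    (h : ∀ j, IsCompletelyJoinIrreducible j → j ≤ a → j ≤ b) : a ≤ b := by
  by_contra hab
  obtain ⟨m, hm1, hm2, hm⟩ := hA.exists_meetIrreducible
    (mt (NelsonAlgebra.le_iff_sneg_le a b).2 hab)
  exact hm2 (sneg_le_iff.1 (h _ (isCompletelyJoinIrreducible_sneg hm) (sneg_le_iff.1 hm1)))

/-- The partner of a completely join-irreducible element `j`: the least element that is not below
`∼j`. -/
theorem IsCompletelyJoinIrreducible.exists_partner (hA : IsAlgebraicLattice A) {j : A}
    (hj : IsCompletelyJoinIrreducible j) :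
    ∃ k, IsCompletelyJoinIrreducible k ∧ ∀ x, k ≤ x ↔ ¬ x ≤ sneg j := by
  obtain ⟨w, hw⟩ := hA.1 {x | ¬ j ≤ x}
  have hjw : ¬ j ≤ w := fun h => by
    obtain ⟨b, hb, hjb⟩ := hj.exists_le_of_le_isLUB hA hw h
    exact hb hjb
  have key : ∀ x, x ≤ w ↔ ¬ j ≤ x := fun x => ⟨fun h h' => hjw (h'.trans h), fun h => hw.1 h⟩
  refine ⟨sneg w, isCompletelyJoinIrreducible_sneg fun S hS => ?_, fun x => ?_⟩
  · obtain ⟨b, hb, hjb⟩ : ∃ b ∈ S, ¬ j ≤ b := by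
      by_contra! h
      exact hjw (hS.2 h)
    exact (hS.1 hb).antisymm ((key b).2 hjb) ▸ hb
  · rw [sneg_le_iff, key, le_sneg_iff]

/-- The Monteiro space of completely join-irreducible elements represents the Nelson algebra. -/
theorem exists_monteiroSpace_joinIrreducibles (hA : IsAlgebraicLattice A) :
    ∃ _ : MonteiroSpace (JoinIrreducibles A),
      (∀ j : JoinIrreducibles A,
        IsGLB {x : A | ¬ x ≤ sneg j.val} (MonteiroSpace.g j).val) ∧
      A ≅ₙ Upsets (JoinIrreducibles A) := by
  have irr : ∀ j : JoinIrreducibles A, IsCompletelyJoinIrreducible j.val := fun j => j.2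
  have le_iff : ∀ i j : JoinIrreducibles A, i ≤ j ↔ j.val ≤ i.val := fun i j => Iff.rfl
  obtain ⟨g, hg⟩ : ∃ g : JoinIrreducibles A → JoinIrreducibles A,
      ∀ j x, (g j).val ≤ x ↔ ¬ x ≤ sneg j.val :=
    ⟨fun j => OrderDual.toDual ⟨_, ((irr j).exists_partner hA).choose_spec.1⟩,
      fun j => ((irr j).exists_partner hA).choose_spec.2⟩
  have le_sneg : ∀ (j : JoinIrreducibles A) x, j.val ≤ sneg x ↔ ¬ (g j).val ≤ x := fun j x => by
    rw [hg, not_not, le_sneg_iff]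
  have gg : ∀ j, g (g j) = j := fun j => by
    have : ∀ x, (g (g j)).val ≤ x ↔ j.val ≤ x := fun x => by
      rw [hg, le_sneg_iff, hg, not_not, ← NelsonAlgebra.le_iff_sneg_le]
    exact Subtype.ext (le_antisymm ((this _).2 le_rfl) ((this _).1 le_rfl))
  have anti : ∀ {i j : JoinIrreducibles A}, j.val ≤ i.val → (g i).val ≤ (g j).val :=
    fun {i j} h => (hg i _).2 fun h' => (hg j _).1 le_rfl
      (h'.trans ((NelsonAlgebra.le_iff_sneg_le _ _).1 h))
  let M : MonteiroSpace (JoinIrreducibles A) := {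
    g := g
    antitone_g := fun i j h => anti h
    g_g := gg
    le_or_le := fun j => by
      by_cases h : (g j).val ≤ j.val
      · exact .inl h
      · refine .inr ?_
        have hj := (le_sneg j _).2 h
        have h1 := (le_inf le_rfl hj).trans (NelsonAlgebra.inf_sneg_le _ (g j).val)
        exact (((irr j).le_sup_iff hA).1 h1).resolve_right fun h' => (le_sneg j _).1 h' le_rfl
    interpolation := fun i j hi hij hji hj => by
      have h1 : ¬ i.val ≤ imp i.val (imp j.val (sneg j.val)) := fun h => by
        rw [← NelsonAlgebra.le_imp_iff, inf_idem, (irr i).le_sup_iff hA, le_sneg,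
          ← NelsonAlgebra.le_imp_iff, sup_idem] at h
        rcases h with h | h
        · exact h hi
        · exact (le_sneg (g j) _).1 ((le_inf hj hij).trans h) (by rw [gg])
      rw [← NelsonAlgebra.inf_imp, ← NelsonAlgebra.le_imp_iff] at h1
      obtain ⟨k, hk, hk1, hk2⟩ : ∃ k, IsCompletelyJoinIrreducible k ∧ k ≤ i.val ⊓ j.val ∧
          ¬ k ≤ sneg (i.val ⊓ j.val) := by
        by_contra! h
        exact h1 (inf_le_left.trans ((hA.le_of_forall_joinIrreducible h).trans le_sup_left))
      let k' : JoinIrreducibles A := OrderDual.toDual ⟨k, hk⟩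
      have hk3 : (g k').val ≤ i.val ⊓ j.val := not_not.1 (mt (le_sneg k' _).2 hk2)
      have hk4 : ∀ l : JoinIrreducibles A, (g k').val ≤ l.val → (g l).val ≤ k'.val :=
        fun l hl => by simpa [gg] using anti hl
      exact ⟨k', hk1.trans inf_le_left, hk1.trans inf_le_right,
        hk4 i (hk3.trans inf_le_left), hk4 j (hk3.trans inf_le_right)⟩ }
  refine ⟨M, fun j => ⟨fun x hx => (hg j x).2 hx, fun w hw => hw ((hg j _).1 le_rfl)⟩,
    nelsonIsomorphic_iff.2 ?_⟩
  let F : A → Upsets (JoinIrreducibles A) := fun a =>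
    ⟨{j | (WithUpperSet.ofUpperSet j).val ≤ a}, fun i j h hi =>
      le_trans (show (WithUpperSet.ofUpperSet j).val ≤ (WithUpperSet.ofUpperSet i).val from h) hi⟩
  have hF : ∀ {a b}, F a ≤ F b ↔ a ≤ b := fun {a b} =>
    ⟨fun h => hA.le_of_forall_joinIrreducible fun j hj hja =>
      @h (WithUpperSet.toUpperSet (OrderDual.toDual ⟨j, hj⟩)) hja, fun h j hj => le_trans hj h⟩
  have surj : Function.Surjective F := fun S => by
    obtain ⟨w, hw⟩ := hA.1 {a | ∃ j : JoinIrreducibles A, WithUpperSet.toUpperSet j ∈ S ∧ j.val = a}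
    refine ⟨w, Opens.ext (Set.ext fun j => ⟨fun hj => ?_, fun hj => hw.1 ⟨j, hj, rfl⟩⟩)⟩
    obtain ⟨_, ⟨k, hk, rfl⟩, hjk⟩ := (irr (WithUpperSet.ofUpperSet j)).exists_le_of_le_isLUB hA hw hj
    exact mem_upsets_of_le S (x := k) (y := WithUpperSet.ofUpperSet j) hjk hk
  exact ⟨{ Equiv.ofBijective F ⟨fun a b h => (hF.1 h.le).antisymm (hF.1 h.ge), surj⟩
    with map_rel_iff' := hF }, fun a => Opens.ext (Set.ext fun j => le_sneg _ a)⟩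

end Algebraic

theorem mainTheorem3 :
    -- rough sets induced by a quasiorder form an algebraic lattice
    (∀ (U : Type u) (R : U → U → Prop) [IsPreorder U R], IsAlgebraicLattice (RoughSet R)) ∧
    -- a Nelson algebra on an algebraic lattice is one of rough sets induced by a quasiorder
    (∀ (A : Type u) [DistribLattice A] [BoundedOrder A] [NelsonAlgebra A],
      IsAlgebraicLattice A →
        ∃ (U : Type u) (R : U → U → Prop) (_ : IsPreorder U R), A ≅ₙ RoughSet R) ∧
    -- a Nelson algebra on an Alexandrov T0-topology is one on an algebraic lattice
    (∀ (X : Type u) [TopologicalSpace X] [AlexandrovDiscrete X] [T0Space X]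
      [NelsonAlgebra (Opens X)], IsAlgebraicLattice (Opens X)) ∧
    -- a Nelson algebra on an algebraic lattice is one on an Alexandrov T0-topology
    (∀ (A : Type u) [DistribLattice A] [BoundedOrder A] [NelsonAlgebra A],
      IsAlgebraicLattice A →
        ∃ (X : Type u) (_ : TopologicalSpace X) (_ : AlexandrovDiscrete X) (_ : T0Space X)
          (_ : NelsonAlgebra (Opens X)), A ≅ₙ Opens X) ∧
    -- an Alexandrov T0-topology with a Nelson algebra on it is determined by that algebra
    (∀ (X Y : Type u) [TopologicalSpace X] [AlexandrovDiscrete X] [T0Space X]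
      [NelsonAlgebra (Opens X)] [TopologicalSpace Y] [AlexandrovDiscrete Y] [T0Space Y]
      [NelsonAlgebra (Opens Y)],
      Opens X ≅ₙ Opens Y ↔ Nonempty (TopologicalNelsonIso X Y)) ∧
    -- a Monteiro space yields a Nelson algebra on an Alexandrov T0-topology, an algebraic lattice
    (∀ (X : Type u) [PartialOrder X] [MonteiroSpace X],
      AlexandrovDiscrete (WithUpperSet X) ∧ T0Space (WithUpperSet X) ∧
        IsAlgebraicLattice (Upsets X)) ∧
    -- a Nelson algebra on an algebraic lattice is that of a Monteiro space on its completely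
    -- join-irreducible elements
    (∀ (A : Type u) [DistribLattice A] [BoundedOrder A] [NelsonAlgebra A],
      IsAlgebraicLattice A →
        ∃ _ : MonteiroSpace (JoinIrreducibles A),
          (∀ j : JoinIrreducibles A,
            IsGLB {x : A | ¬ x ≤ NelsonAlgebra.sneg j.val} (MonteiroSpace.g j).val) ∧
          A ≅ₙ Upsets (JoinIrreducibles A)) ∧
    -- a Monteiro space is determined by its Nelson algebra
    (∀ (X Y : Type u) [PartialOrder X] [MonteiroSpace X] [PartialOrder Y] [MonteiroSpace Y],
      Upsets X ≅ₙ Upsets Y ↔ Nonempty (MonteiroIso X Y)) := by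
  have rep : ∀ (A : Type u) [DistribLattice A] [BoundedOrder A] [NelsonAlgebra A],
      IsAlgebraicLattice A → ∃ (X : Type u) (_ : PartialOrder X) (_ : MonteiroSpace X),
        A ≅ₙ Upsets X := fun A _ _ _ hA =>
    have ⟨M, _, h⟩ := exists_monteiroSpace_joinIrreducibles hA
    ⟨_, _, M, h⟩
  refine ⟨fun U R _ => isAlgebraicLattice_roughSet R, fun A _ _ _ hA => ?_,
    fun X _ _ _ _ => isAlgebraicLattice_opens X, fun A _ _ _ hA => ?_,
    fun X Y _ _ _ _ _ _ _ _ => opens_nelsonIsomorphic_iff,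
    fun X _ _ => ⟨inferInstance, inferInstance, isAlgebraicLattice_opens _⟩,
    fun A _ _ _ hA => exists_monteiroSpace_joinIrreducibles hA,
    fun X Y _ _ _ _ => upsets_nelsonIsomorphic_iff⟩
  · obtain ⟨X, _, _, h⟩ := rep A hA
    obtain ⟨R, hR, h'⟩ := exists_upsets_nelsonIsomorphic_roughSet X
    exact ⟨X, R, hR, h.trans h'⟩
  · obtain ⟨X, _, _, h⟩ := rep A hA
    exact ⟨WithUpperSet X, inferInstance, inferInstance, inferInstance, inferInstance, h⟩
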